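/- Let $(A(t))_{t\ge 0}$ be i.i.d. random variables with values in $\mathbb{N}=\{0,1,2,\dots\}$ (the number of packets arriving in frame $t$), with $0<\mathbb{E}[A]<\infty$, where $A=A(0)$. Let $B\in\mathbb{N}$ be the buffer size, $\sigma>0$ the packet size, $\Delta t>0$ the frame duration, and $\varepsilon,\delta_0\in\mathbb{R}$. For an integer $S\ge 1$ (the number of packets that can be played out per frame, i.e. playout rate $S\sigma/\Delta t$) consider the infinite-buffer queue $$Q(0)=0,\qquad Q(t+1)=\max\{S,Q(t)\}-S+A(t),$$ and the finite-buffer queue $$Q_B(0)=0,\qquad Q_B(t+1)=\min\{B,\ \max\{S,Q_B(t)\}-S+A(t)\}.$$ The number of packets dropped in frame $t$ is $D(t)=\max\{S,Q_B(t)\}-S+A(t)-Q_B(t+1)$. The outage is the almost sure constant limit $\lim_{T\to\infty}\frac1T\,\#\{t<T: Q_B(t)<S\}$, and the packet drop rate $\delta$ is the almost sure constant limit $\lim_{T\to\infty}\sum_{t<T}D(t)\big/\sum_{t<T}A(t)$ (each when it exists). (1) Let $S$ be an integer with $\mathbb{E}[A]<S<B$. Then each of the two Markov chains $Q$ and $Q_B$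 has exactly one stationary distribution, $(q_i)_{i\ge0}$ and $(q_{i,B})_{0\le i\le B}$ respectively, and $q_i=\lim_{t\to\infty}\mathbb{P}[Q(t)=i]$, $q_{i,B}=\lim_{t\to\infty}\mathbb{P}[Q_B(t)=i]$ for every $i$. The outage exists and equals $\sum_{i=0}^{S-1}q_{i,B}$. Moreover $1-\sum_{i=0}^{S-1}(1-\frac iS)q_i>0$, and the packet drop rate exists and equals $$\delta=\frac{\sum_{i=0}^{S-1}\left(1-\frac iS\right)\left(q_{i,B}-q_i\right)}{1-\sum_{i=0}^{S-1}\left(1-\frac iS\right)q_i}.$$ (2) Let $\mathcal{U}$ be the set of all rates $S\sigma/\Delta t$ with $S$ an integer, $\mathbb{E}[A]<S<B$, such that $$\sum_{i=0}^{S-1}q_{i,B}\le\varepsilon\qquad\text{and}\qquad \frac{\sum_{i=0}^{S-1}\left(1-\frac iS\right)\left(q_{i,B}-q_i\right)}{1-\sum_{i=0}^{S-1}\left(1-\frac iS\right)q_i}\le\delta_0,$$ where $q_i$ and $q_{i,B}$ are the stationary probabilities for this $S$. If $\mathcal{U}\neq\emptyset$, then $\mathcal{U}$ has a largest element $U=\max\mathcal{U}$,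 and $U$ is the maximum constant playout rate with outage at most $\varepsilon$ and drop rate at most $\delta_0$: it is the largest of all rates $S\sigma/\Delta t$ with $S$ an integer, $0<S<B$, for which the outage and the packet drop rate exist and are at most $\varepsilon$ and at most $\delta_0$, respectively. -/

import Mathlib

open MeasureTheory ProbabilityTheory Filter Topology

namespace PlayoutQueue

/-- Number of packets in the infinite buffer at the start of frame `t`:
`Q(0) = 0`, `Q(t+1) = max{S, Q(t)} - S + A(t)`. -/
def queue {Ω : Type*} (S : ℕ) (A : ℕ → Ω → ℕ) : ℕ → Ω → ℕ
  | 0, _ => 0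
  | t + 1, ω => max S (queue S A t ω) - S + A t ω

/-- Number of packets in the buffer of size `B` at the start of frame `t`:
`Q_B(0) = 0`, `Q_B(t+1) = min{B, max{S, Q_B(t)} - S + A(t)}`. -/
def buffer {Ω : Type*} (B S : ℕ) (A : ℕ → Ω → ℕ) : ℕ → Ω → ℕ
  | 0, _ => 0
  | t + 1, ω => min B (max S (buffer B S A t ω) - S + A t ω)

/-- Number of packets arriving in frame `t` that are dropped: the packets left after playout plus
the arrivals, minus what is actually stored (the subtraction never truncates). -/
def dropped {Ω : Type*} (B S : ℕ) (A : ℕ → Ω → ℕ) (t : ℕ) (ω : Ω) : ℕ :=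
  (max S (buffer B S A t ω) - S + A t ω) - buffer B S A (t + 1) ω

/-- The outage is `p`: almost surely, the long-run fraction of frames that start with fewer than
`S` packets in the finite buffer equals `p`. -/
def HasOutage {Ω : Type*} [MeasurableSpace Ω] (μ : Measure Ω) (A : ℕ → Ω → ℕ) (B S : ℕ)
    (p : ℝ) : Prop :=
  ∀ᵐ ω ∂μ, Tendsto
    (fun T : ℕ => (((Finset.range T).filter (fun t => buffer B S A t ω < S)).card : ℝ) / (T : ℝ))
    atTop (𝓝 p)

/-- The packet drop rate is `d`: almost surely, the long-run ratio of the number of dropped packets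
to the number of arrived packets equals `d`. -/
def HasDropRate {Ω : Type*} [MeasurableSpace Ω] (μ : Measure Ω) (A : ℕ → Ω → ℕ) (B S : ℕ)
    (d : ℝ) : Prop :=
  ∀ᵐ ω ∂μ, Tendsto
    (fun T : ℕ => (∑ t ∈ Finset.range T, (dropped B S A t ω : ℝ)) /
      (∑ t ∈ Finset.range T, (A t ω : ℝ)))
    atTop (𝓝 d)

/-- Transition kernel of the infinite-buffer chain when `a` is the law of the number of arrivals
in a frame. -/
noncomputable def queueKernel (a : Measure ℕ) (S : ℕ) : Kernel ℕ ℕ where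
  toFun i := a.map (fun k => max S i - S + k)
  measurable' := measurable_of_countable _

/-- Transition kernel of the finite-buffer chain. It is defined on all of `ℕ`, but every transition
leads into `{0, …, B}`, so its stationary distributions are those of the chain on `{0, …, B}`. -/
noncomputable def bufferKernel (a : Measure ℕ) (B S : ℕ) : Kernel ℕ ℕ where
  toFun i := a.map (fun k => min B (max S i - S + k))
  measurable' := measurable_of_countable _

/-- `q` is a stationary probability distribution of the Markov chain with kernel `κ`. -/
def IsStationary (κ : Kernel ℕ ℕ) (q : Measure ℕ) : Prop :=
  IsProbabilityMeasure q ∧ κ.Invariant q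

/-- `∑_{i<S} q_{i,B}`. -/
noncomputable def outageValue (S : ℕ) (qB : Measure ℕ) : ℝ :=
  ∑ i ∈ Finset.range S, qB.real {i}

/-- `1 - ∑_{i<S} (1 - i/S) q_i`. -/
noncomputable def dropDenominator (S : ℕ) (q : Measure ℕ) : ℝ :=
  1 - ∑ i ∈ Finset.range S, (1 - (i : ℝ) / (S : ℝ)) * q.real {i}

/-- `∑_{i<S} (1 - i/S) (q_{i,B} - q_i) / (1 - ∑_{i<S} (1 - i/S) q_i)`. -/
noncomputable def dropValue (S : ℕ) (q qB : Measure ℕ) : ℝ :=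
  (∑ i ∈ Finset.range S, (1 - (i : ℝ) / (S : ℝ)) * (qB.real {i} - q.real {i})) /
    dropDenominator S q

/-- The playout rates `S σ / Δt` with `0 < S < B` for which the queueing process itself has outage
at most `ε` and packet drop rate at most `δ₀`. -/
def feasibleRates {Ω : Type*} [MeasurableSpace Ω] (μ : Measure Ω) (A : ℕ → Ω → ℕ) (B : ℕ)
    (σ Δt ε δ₀ : ℝ) : Set ℝ :=
  {u | ∃ S : ℕ, 0 < S ∧ S < B ∧ u = (S : ℝ) * σ / Δt ∧
    (∃ p, HasOutage μ A B S p ∧ p ≤ ε) ∧ (∃ d, HasDropRate μ A B S d ∧ d ≤ δ₀)}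

/-- The playout rates `S σ / Δt` with `E[A] < S < B` that satisfy the two constraints written
through the stationary distributions; `a` is the law of the number of arrivals in a frame. -/
def stationaryRates (a : Measure ℕ) (B : ℕ) (σ Δt ε δ₀ : ℝ) : Set ℝ :=
  {u | ∃ S : ℕ, (∫ k, (k : ℝ) ∂a) < (S : ℝ) ∧ S < B ∧ u = (S : ℝ) * σ / Δt ∧
    ∃ q qB : Measure ℕ, IsStationary (queueKernel a S) q ∧ IsStationary (bufferKernel a B S) qB ∧
      outageValue S qB ≤ ε ∧ dropValue S q qB ≤ δ₀}

end PlayoutQueue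

/-! For both chains, `max S x - S + k ≤ j` means `k ≤ j` and `x ≤ S + j - k`, so one frame acts on
distribution functions by a monotone operator, `cdfStep`, which is constantly 1 at thresholds the
truncation makes trivial. Started empty, the iterates decrease to a fixed point, and a maximum
principle (`le_of_cdfStep_eq`) shows that a fixed point is determined by its limit at infinity. That
limit is trivially 1 for the finite buffer; for the infinite queue it is 1 because of negative drift
(`tendsto_one_of_cdfIter_queueStep`).

Long-run frequencies of the buffer come from a monotone coupling: the state is squeezed between
chains restarted `n` frames earlier from 0 and from `B`. These windows obey the strong law, and
their laws have the same limit (`ae_tendsto_frequency`).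

By conservation of packets, the drops per frame are E[A] - S plus the buffer's mean unused capacity,
the mean of (S - Q_B)⁺. Stationarity of the infinite queue says that its own mean unused capacity is
S - E[A] (`sum_real_Iic_of_stationary`). Together these give the formula for δ.

For the optimisation, only finitely many `S < B` compete, and a rate with `S ≤ E[A]` lies below
every member of the stationary set. -/

namespace PlayoutQueue

/-! ### Paths of the chains as functions of the arrivals. -/

/-- State after `t` frames of the chain with one-step map `f`, started at `x` and driven by the
arrivals `a`. -/
def path (f : ℕ → ℕ → ℕ) (x : ℕ) (a : ℕ → ℕ) : ℕ → ℕ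
  | 0 => x
  | t + 1 => f (path f x a t) (a t)

theorem path_mono {f : ℕ → ℕ → ℕ} (hf : ∀ k, Monotone fun x => f x k) {x y : ℕ} (hxy : x ≤ y)
    (a : ℕ → ℕ) (t : ℕ) : path f x a t ≤ path f y a t := by
  induction t with
  | zero => exact hxy
  | succ t ih => exact hf _ ih

theorem path_add (f : ℕ → ℕ → ℕ) (x : ℕ) (a : ℕ → ℕ) (s t : ℕ) :
    path f x a (s + t) = path f (path f x a s) (fun i => a (s + i)) t := by
  induction t with
  | zero => rfl
  | succ t ih => exact congrArg (f · (a (s + t))) ih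

theorem path_congr (f : ℕ → ℕ → ℕ) (x : ℕ) {a b : ℕ → ℕ} {t : ℕ} (h : ∀ i < t, a i = b i) :
    path f x a t = path f x b t := by
  induction t with
  | zero => rfl
  | succ t ih =>
    simp only [path]
    rw [ih fun i hi => h i (by omega), h t (by omega)]

/-- One-step map of the infinite-buffer chain. -/
def queueStep (S x k : ℕ) : ℕ := max S x - S + k

/-- One-step map of the finite-buffer chain. -/
def bufferStep (B S x k : ℕ) : ℕ := min B (max S x - S + k)

theorem queue_eq_path {Ω : Type*} (S : ℕ) (A : ℕ → Ω → ℕ) (t : ℕ) (ω : Ω) :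
    queue S A t ω = path (queueStep S) 0 (A · ω) t := by
  induction t with
  | zero => rfl
  | succ t ih => simp only [queue, path, queueStep, ih]

theorem buffer_eq_path {Ω : Type*} (B S : ℕ) (A : ℕ → Ω → ℕ) (t : ℕ) (ω : Ω) :
    buffer B S A t ω = path (bufferStep B S) 0 (A · ω) t := by
  induction t with
  | zero => rfl
  | succ t ih => simp only [buffer, path, bufferStep, ih]

theorem buffer_le {Ω : Type*} (B S : ℕ) (A : ℕ → Ω → ℕ) (t : ℕ) (ω : Ω) :
    buffer B S A t ω ≤ B := by
  cases t with
  | zero => exact Nat.zero_le _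
  | succ t => exact min_le_left _ _

/-! ### The operator on distribution functions and its fixed points. -/

/-- `f` is the one-step map of a queue with playout `S` per frame, possibly truncated at some
level: each threshold `j` is either above the truncation level or unaffected by it. -/
def IsPlayoutStep (S : ℕ) (f : ℕ → ℕ → ℕ) : Prop :=
  ∀ j, (∀ x k, f x k ≤ j) ∨ ∀ x k, f x k ≤ j ↔ max S x - S + k ≤ j

theorem isPlayoutStep_queueStep (S : ℕ) : IsPlayoutStep S (queueStep S) :=
  fun _ => Or.inr fun _ _ => Iff.rfl

theorem isPlayoutStep_bufferStep (B S : ℕ) : IsPlayoutStep S (bufferStep B S) := by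
  intro j
  simp only [bufferStep]
  by_cases h : B ≤ j
  · exact Or.inl fun _ _ => (min_le_left _ _).trans h
  · exact Or.inr fun _ _ => by omega

theorem IsPlayoutStep.monotone {S : ℕ} {f : ℕ → ℕ → ℕ} (hf : IsPlayoutStep S f) (k : ℕ) :
    Monotone fun x => f x k := by
  intro x y hxy
  -- Taking the value `f y k` itself as threshold turns the comparison into a threshold statement.
  rcases hf (f y k) with h | h
  · exact h _ _
  · have := (h y k).1 le_rfl
    exact (h x k).2 (by omega)

/-- The map on distribution functions induced by one step of the chain `f`, when `p` is the
probability mass function of the arrivals. -/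
noncomputable def cdfStep (S : ℕ) (f : ℕ → ℕ → ℕ) (p F : ℕ → ℝ) (j : ℕ) : ℝ :=
  open Classical in
  if ∀ x k, f x k ≤ j then 1 else ∑ k ∈ Finset.range (j + 1), p k * F (S + j - k)

section cdfStep

variable {S : ℕ} {f : ℕ → ℕ → ℕ} {p F G : ℕ → ℝ}

theorem cdfStep_mono (hp : ∀ k, 0 ≤ p k) (h : ∀ j, F j ≤ G j) (j : ℕ) :
    cdfStep S f p F j ≤ cdfStep S f p G j := by
  unfold cdfStep
  split_ifs
  · exact le_rfl
  · exact Finset.sum_le_sum fun k _ => mul_le_mul_of_nonneg_left (h _) (hp k)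

theorem cdfStep_le_one (hp : ∀ k, 0 ≤ p k) (hp1 : ∀ n, ∑ k ∈ Finset.range n, p k ≤ 1)
    (h : ∀ j, F j ≤ 1) (j : ℕ) : cdfStep S f p F j ≤ 1 := by
  unfold cdfStep
  split_ifs
  · exact le_rfl
  · refine le_trans (Finset.sum_le_sum fun k _ => ?_) (hp1 (j + 1))
    exact mul_le_of_le_one_right (hp k) (h _)

/-- Each threshold involves only finitely many terms, so pointwise convergence suffices. -/
theorem tendsto_cdfStep {Fs : ℕ → ℕ → ℝ} (h : ∀ j, Tendsto (fun n => Fs n j) atTop (𝓝 (F j)))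
    (j : ℕ) : Tendsto (fun n => cdfStep S f p (Fs n) j) atTop (𝓝 (cdfStep S f p F j)) := by
  unfold cdfStep
  split_ifs
  · exact tendsto_const_nhds
  · exact tendsto_finsetSum _ fun k _ => (h _).const_mul _

/-- Limits of the iterates of `cdfStep` are fixed points. -/
theorem cdfStep_eq_of_tendsto {Fs : ℕ → ℕ → ℝ} (hs : ∀ n j, Fs (n + 1) j = cdfStep S f p (Fs n) j)
    (h : ∀ j, Tendsto (fun n => Fs n j) atTop (𝓝 (F j))) (j : ℕ) :
    cdfStep S f p F j = F j := by
  refine tendsto_nhds_unique (tendsto_cdfStep h j) ?_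
  simp_rw [← hs]
  exact (tendsto_add_atTop_iff_nat 1).2 (h j)

/-- Maximum principle for fixed points of `cdfStep`. -/
theorem le_of_cdfStep_eq (hp : ∀ k, 0 ≤ p k) (hp1 : ∀ n, ∑ k ∈ Finset.range n, p k ≤ 1)
    (hk : ∃ k < S, 0 < p k) (hF : ∀ j, cdfStep S f p F j = F j)
    (hG : ∀ j, cdfStep S f p G j = G j) (hlim : Tendsto (fun j => F j - G j) atTop (𝓝 0)) (j : ℕ) :
    F j ≤ G j := by
  by_contra! hj
  obtain ⟨N, hN⟩ := eventually_atTop.1 (hlim.eventually (gt_mem_nhds (sub_pos.2 hj)))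
  have hjN : j < N := by
    by_contra! h
    exact lt_irrefl _ (hN j h)
  -- Beyond `N` the difference is below its value at `j`, so its supremum is a maximum, attained at
  -- some `i < N`.
  obtain ⟨i, hi, himax⟩ := Finset.exists_max_image (Finset.range N) (fun i => F i - G i) ⟨j, by simpa⟩
  have hle : ∀ n, F n - G n ≤ F i - G i := by
    intro n
    by_cases hn : n < N
    · exact himax n (by simpa)
    · exact (hN n (by omega)).le.trans (himax j (by simpa))
  have hMpos : 0 < F i - G i := (sub_pos.2 hj).trans_le (hle j)
  obtain ⟨N', hN'⟩ := eventually_atTop.1 (hlim.eventually (gt_mem_nhds hMpos))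
  let P : ℕ → Prop := fun n => F n - G n = F i - G i
  classical
  -- `l` is the last index where the maximum is attained; it exists because the difference tends to
  -- 0 and the maximum is positive.
  let l := Nat.findGreatest P N'
  have hiN' : i ≤ N' := by
    by_contra! h
    exact lt_irrefl _ (hN' i h.le)
  have hl : F l - G l = F i - G i := Nat.findGreatest_spec (P := P) hiN' rfl
  have hgt : ∀ n, l < n → F n - G n < F i - G i := by
    intro n hn
    by_cases h : n ≤ N'
    · exact lt_of_le_of_ne (hle n) (Nat.findGreatest_is_greatest (P := P) hn h)
    · exact hN' n (by omega)
  have hFl := hF l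
  have hGl := hG l
  unfold cdfStep at hFl hGl
  split_ifs at hFl hGl with hc
  · linarith
  · have hsum : ∑ k ∈ Finset.range (l + 1), p k * (F (S + l - k) - G (S + l - k)) = F i - G i := by
      simp_rw [mul_sub, Finset.sum_sub_distrib]
      linarith
    obtain ⟨k, hkS, hpk⟩ := hk
    -- If `k ≤ l`, then `S + l - k > l` carries positive weight and a value strictly below the
    -- maximum. If `k > l`, the weights used miss `p k` and sum to less than 1. Either way the sum
    -- falls short of the positive maximum.
    by_cases hkl : k ≤ l
    · have h1 : ∑ k ∈ Finset.range (l + 1), p k * (F (S + l - k) - G (S + l - k)) <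
          ∑ k ∈ Finset.range (l + 1), p k * (F i - G i) := by
        refine Finset.sum_lt_sum (fun n _ => mul_le_mul_of_nonneg_left (hle _) (hp n))
          ⟨k, by simp; omega, mul_lt_mul_of_pos_left (hgt _ (by omega)) hpk⟩
      rw [← Finset.sum_mul] at h1
      nlinarith [hp1 (l + 1)]
    · have h1 : ∑ n ∈ Finset.range (l + 1), p n * (F (S + l - n) - G (S + l - n)) ≤
          ∑ n ∈ Finset.range (l + 1), p n * (F i - G i) :=
        Finset.sum_le_sum fun n _ => mul_le_mul_of_nonneg_left (hle _) (hp n)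
      rw [← Finset.sum_mul] at h1
      have h2 : ∑ n ∈ Finset.range (l + 1), p n + p k ≤ 1 := by
        refine le_trans ?_ (hp1 (k + 1))
        rw [Finset.sum_range_succ _ k]
        refine add_le_add_left (Finset.sum_le_sum_of_subset_of_nonneg ?_ fun _ _ _ => hp _) _
        exact Finset.range_subset_range.2 (by omega)
      nlinarith [mul_pos hpk hMpos]

/-- A fixed point of `cdfStep` is determined by its limit. -/
theorem eq_of_cdfStep_eq (hp : ∀ k, 0 ≤ p k) (hp1 : ∀ n, ∑ k ∈ Finset.range n, p k ≤ 1)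
    (hk : ∃ k < S, 0 < p k) (hF : ∀ j, cdfStep S f p F j = F j)
    (hG : ∀ j, cdfStep S f p G j = G j) {c : ℝ} (hFc : Tendsto F atTop (𝓝 c))
    (hGc : Tendsto G atTop (𝓝 c)) : F = G := by
  funext j
  refine le_antisymm (le_of_cdfStep_eq hp hp1 hk hF hG ?_ j) (le_of_cdfStep_eq hp hp1 hk hG hF ?_ j)
  · simpa using hFc.sub hGc
  · simpa using hGc.sub hFc

end cdfStep

/-! ### Measures on ℕ through their distribution functions. -/

/-- Turns kernel invariance into invariance under `f` applied to a state and an independent arrival.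
-/
theorem bind_eq_map_prod (q a : Measure ℕ) [SFinite a] (f : ℕ → ℕ → ℕ) (κ : Kernel ℕ ℕ)
    (hκ : ∀ i, κ i = a.map (f i)) : q.bind κ = (q.prod a).map fun z => f z.1 z.2 := by
  ext s hs
  rw [Measure.bind_apply hs κ.measurable.aemeasurable, Measure.map_apply (by fun_prop) hs,
    Measure.prod_apply .of_discrete]
  refine lintegral_congr fun i => ?_
  rw [hκ, Measure.map_apply (by fun_prop) hs]
  rfl

theorem isStationary_queueKernel_iff {a q : Measure ℕ} [SFinite a] (S : ℕ) :
    IsStationary (queueKernel a S) q ↔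
      IsProbabilityMeasure q ∧ ((q.prod a).map fun z => queueStep S z.1 z.2) = q := by
  rw [← bind_eq_map_prod q a (queueStep S) (queueKernel a S) fun _ => rfl]
  rfl

theorem isStationary_bufferKernel_iff {a q : Measure ℕ} [SFinite a] (B S : ℕ) :
    IsStationary (bufferKernel a B S) q ↔
      IsProbabilityMeasure q ∧ ((q.prod a).map fun z => bufferStep B S z.1 z.2) = q := by
  rw [← bind_eq_map_prod q a (bufferStep B S) (bufferKernel a B S) fun _ => rfl]
  rfl

theorem real_map_prod_Iic {S : ℕ} {f : ℕ → ℕ → ℕ} (hf : IsPlayoutStep S f) (q a : Measure ℕ)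
    [IsProbabilityMeasure q] [IsProbabilityMeasure a] (j : ℕ) :
    ((q.prod a).map fun z => f z.1 z.2).real (Set.Iic j) =
      cdfStep S f (fun k => a.real {k}) (fun i => q.real (Set.Iic i)) j := by
  rw [map_measureReal_apply (by fun_prop) .of_discrete]
  unfold cdfStep
  split_ifs with hc
  · have : (fun z : ℕ × ℕ => f z.1 z.2) ⁻¹' Set.Iic j = Set.univ := by ext z; simp [hc]
    rw [this, probReal_univ]
  · have hj := (hf j).resolve_left hc
    have : (fun z : ℕ × ℕ => f z.1 z.2) ⁻¹' Set.Iic j =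
        ⋃ k ∈ Finset.range (j + 1), Set.Iic (S + j - k) ×ˢ {k} := by
      ext ⟨x, k⟩
      simp only [Set.mem_preimage, Set.mem_Iic, hj, Set.mem_iUnion, Set.mem_prod,
        Set.mem_singleton_iff, Finset.mem_range, exists_prop]
      constructor
      · intro h
        exact ⟨k, by omega, by omega, rfl⟩
      · rintro ⟨l, h1, h2, rfl⟩
        omega
    rw [this, measureReal_biUnion_finset]
    · exact Finset.sum_congr rfl fun k _ => by rw [measureReal_prod_prod, mul_comm]
    · intro k _ l _ hkl
      simp only [Function.onFun, Set.disjoint_prod]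
      exact Or.inr (Set.disjoint_singleton.2 hkl)
    · exact fun _ _ => .of_discrete

theorem ext_of_real_Iic {q r : Measure ℕ} [IsProbabilityMeasure q] [IsProbabilityMeasure r]
    (h : ∀ j, q.real (Set.Iic j) = r.real (Set.Iic j)) : q = r :=
  Measure.ext_of_Iic q r fun j => (measureReal_eq_measureReal_iff).1 (h j)

theorem tendsto_real_Iic (q : Measure ℕ) [IsProbabilityMeasure q] :
    Tendsto (fun j => q.real (Set.Iic j)) atTop (𝓝 1) := by
  have := (ENNReal.tendsto_toReal (measure_ne_top q Set.univ)).comp (tendsto_measure_Iic_atTop q)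
  simpa [Function.comp_def, measureReal_def] using this

theorem real_Iic_succ (q : Measure ℕ) [IsProbabilityMeasure q] (i : ℕ) :
    q.real (Set.Iic (i + 1)) = q.real (Set.Iic i) + q.real {i + 1} := by
  rw [← measureReal_union (by simp) .of_discrete]
  congr 1
  ext x
  simp
  omega

/-- The increments of `F` serve as point masses: monotonicity makes them nonnegative and the limit
gives total mass 1. -/
theorem exists_measure_of_cdf {F : ℕ → ℝ} (hmono : Monotone F) (h0 : ∀ j, 0 ≤ F j)
    (hlim : Tendsto F atTop (𝓝 1)) :
    ∃ q : Measure ℕ, IsProbabilityMeasure q ∧ ∀ j, q.real (Set.Iic j) = F j := by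
  let g : ℕ → ℝ := fun i => Nat.casesOn i (F 0) fun i => F (i + 1) - F i
  have hg : ∀ i, 0 ≤ g i := by
    rintro (_ | i)
    · exact h0 0
    · exact sub_nonneg.2 (hmono (Nat.le_succ i))
  have hsum : ∀ j, ∑ i ∈ Finset.range (j + 1), g i = F j := by
    intro j
    induction j with
    | zero => simp [g]
    | succ j ih => rw [Finset.sum_range_succ, ih]; simp [g]
  let q : Measure ℕ := Measure.count.withDensity fun i => ENNReal.ofReal (g i)
  have hq : ∀ j, q (Set.Iic j) = ENNReal.ofReal (F j) := by
    intro j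
    have h1 : ∀ i, q {i} = ENNReal.ofReal (g i) := by
      intro i
      simp only [q]
      rw [withDensity_apply _ .of_discrete, lintegral_singleton]
      simp
    have h2 : Set.Iic j = (Finset.range (j + 1) : Set ℕ) := by
      ext x
      simp
    rw [h2, ← sum_measure_singleton, ← hsum, ENNReal.ofReal_sum_of_nonneg fun i _ => hg i]
    exact Finset.sum_congr rfl fun i _ => h1 i
  refine ⟨q, ⟨?_⟩, fun j => ?_⟩
  · refine tendsto_nhds_unique (tendsto_measure_Iic_atTop q) ?_
    simp_rw [hq]
    simpa using ENNReal.tendsto_ofReal hlim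
  · rw [measureReal_def, hq, ENNReal.toReal_ofReal (h0 j)]

/-! ### Laws of the chain after finitely many frames. -/

/-- Distribution function of the state after `t` frames, started at `x`. -/
noncomputable def cdfIter (S : ℕ) (f : ℕ → ℕ → ℕ) (p : ℕ → ℝ) (x : ℕ) : ℕ → ℕ → ℝ
  | 0, j => if x ≤ j then 1 else 0
  | t + 1, j => cdfStep S f p (cdfIter S f p x t) j

section Law

variable {Ω : Type*} [MeasurableSpace Ω] {μ : Measure Ω} {A : ℕ → Ω → ℕ} {S : ℕ} {f : ℕ → ℕ → ℕ} {a : Measure ℕ}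

theorem measurable_path (hmeas : ∀ t, Measurable (A t)) (f : ℕ → ℕ → ℕ) (x t : ℕ) :
    Measurable fun ω => path f x (A · ω) t := by
  induction t with
  | zero => exact measurable_const
  | succ t ih =>
    exact (measurable_of_countable fun z : ℕ × ℕ => f z.1 z.2).comp (ih.prodMk (hmeas t))

/-- A path reads only finitely many arrivals, so independence of disjoint finite blocks passes to
paths. -/
theorem exists_path_eq (f : ℕ → ℕ → ℕ) (x s n : ℕ) (I : Finset ℕ) (hI : ∀ i < n, s + i ∈ I) :
    ∃ g : (I → ℕ) → ℕ, ∀ a : ℕ → ℕ, path f x (fun i => a (s + i)) n = g fun i => a i := by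
  classical
  refine ⟨fun v => path f x (fun i => if h : s + i ∈ I then v ⟨s + i, h⟩ else 0) n, fun a => ?_⟩
  refine path_congr f x fun i hi => ?_
  simp [hI i hi]

/-- Paths driven by disjoint blocks of arrivals are independent. -/
theorem indepFun_path_path (hmeas : ∀ t, Measurable (A t)) (hindep : iIndepFun A μ)
    (f : ℕ → ℕ → ℕ) (x : ℕ) {s t m : ℕ} (n : ℕ) (hst : s + m ≤ t) :
    IndepFun (fun ω => path f x (fun i => A (s + i) ω) m)
      (fun ω => path f x (fun i => A (t + i) ω) n) μ := by
  obtain ⟨g, hg⟩ := exists_path_eq f x s m (Finset.Ico s (s + m)) (by simp)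
  obtain ⟨h, hh⟩ := exists_path_eq f x t n (Finset.Ico t (t + n)) (by simp)
  have hd : Disjoint (Finset.Ico s (s + m)) (Finset.Ico t (t + n)) := by
    rw [Finset.disjoint_left]
    intro i
    simp
    omega
  have := (hindep.indepFun_finset _ _ hd hmeas).comp (measurable_of_countable g)
    (measurable_of_countable h)
  convert this using 1
  · funext ω
    exact hg (A · ω)
  · funext ω
    exact hh (A · ω)

theorem indepFun_path (hmeas : ∀ t, Measurable (A t)) (hindep : iIndepFun A μ)
    (f : ℕ → ℕ → ℕ) (x t : ℕ) : IndepFun (fun ω => path f x (A · ω) t) (A t) μ := by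
  obtain ⟨g, hg⟩ := exists_path_eq f x 0 t (Finset.range t) (by simp)
  have hd : Disjoint (Finset.range t) {t} := by simp
  have := (hindep.indepFun_finset _ _ hd hmeas).comp (measurable_of_countable g)
    (measurable_pi_apply (⟨t, by simp⟩ : ({t} : Finset ℕ)))
  have h : (fun ω => path f x (A · ω) t) = g ∘ fun ω (i : Finset.range t) => A i ω := by
    funext ω
    simpa using hg (A · ω)
  rw [h]
  exact this

theorem map_path_succ [IsProbabilityMeasure μ] (hmeas : ∀ t, Measurable (A t)) (hindep : iIndepFun A μ)
    (hlaw : ∀ t, μ.map (A t) = a) (f : ℕ → ℕ → ℕ) (x t : ℕ) :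
    μ.map (fun ω => path f x (A · ω) (t + 1)) =
      ((μ.map fun ω => path f x (A · ω) t).prod a).map fun z => f z.1 z.2 := by
  rw [← hlaw t, ← (indepFun_path hmeas hindep f x t).map_prod_eq_prod_map_map
    (measurable_path hmeas f x t).aemeasurable (hmeas t).aemeasurable,
    Measure.map_map (by fun_prop) ((measurable_path hmeas f x t).prodMk (hmeas t))]
  rfl

theorem real_path_le [IsProbabilityMeasure μ] (hf : IsPlayoutStep S f)
    (hmeas : ∀ t, Measurable (A t))
    (hindep : iIndepFun A μ) (hlaw : ∀ t, μ.map (A t) = a) (x t j : ℕ) :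
    (μ.map fun ω => path f x (A · ω) t).real (Set.Iic j) =
      cdfIter S f (fun k => a.real {k}) x t j := by
  have : IsProbabilityMeasure a := hlaw 0 ▸ Measure.isProbabilityMeasure_map (hmeas 0).aemeasurable
  induction t generalizing j with
  | zero =>
    rw [map_measureReal_apply (measurable_path hmeas f x 0) .of_discrete]
    simp only [path, cdfIter]
    split_ifs with h <;> simp [h]
  | succ t ih =>
    have := Measure.isProbabilityMeasure_map (μ := μ) (measurable_path hmeas f x t).aemeasurable
    rw [map_path_succ hmeas hindep hlaw, real_map_prod_Iic hf]
    simp only [cdfIter, ih]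

end Law

section cdfIter

variable {S : ℕ} {f : ℕ → ℕ → ℕ} {p : ℕ → ℝ}

theorem cdfIter_nonneg (hp : ∀ k, 0 ≤ p k) (x t j : ℕ) : 0 ≤ cdfIter S f p x t j := by
  induction t generalizing j with
  | zero => simp only [cdfIter]; split_ifs <;> simp
  | succ t ih =>
    simp only [cdfIter, cdfStep]
    split_ifs
    · exact zero_le_one
    · exact Finset.sum_nonneg fun k _ => mul_nonneg (hp k) (ih _)

theorem cdfIter_le_one (hp : ∀ k, 0 ≤ p k) (hp1 : ∀ n, ∑ k ∈ Finset.range n, p k ≤ 1)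
    (x t j : ℕ) : cdfIter S f p x t j ≤ 1 := by
  induction t generalizing j with
  | zero => simp only [cdfIter]; split_ifs <;> simp
  | succ t ih => exact cdfStep_le_one hp hp1 ih j

/-- The chain started empty has distribution function 1, the largest possible, so the first step
lowers it; monotonicity of `cdfStep` propagates this. -/
theorem cdfIter_zero_antitone (hp : ∀ k, 0 ≤ p k) (hp1 : ∀ n, ∑ k ∈ Finset.range n, p k ≤ 1)
    (j : ℕ) : Antitone fun t => cdfIter S f p 0 t j := by
  refine antitone_nat_of_succ_le fun t => ?_
  induction t generalizing j with
  | zero => exact (cdfIter_le_one hp hp1 0 1 j).trans (by simp [cdfIter])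
  | succ t ih => exact cdfStep_mono hp ih j

/-- The mirror image: a point mass at `B` has the smallest distribution function among laws on `{0,
…, B}`. -/
theorem cdfIter_top_monotone (hp : ∀ k, 0 ≤ p k) {B : ℕ} (hB : ∀ x k, f x k ≤ B)
    (j : ℕ) : Monotone fun t => cdfIter S f p B t j := by
  refine monotone_nat_of_le_succ fun t => ?_
  induction t generalizing j with
  | zero =>
    by_cases h : B ≤ j
    · have : cdfIter S f p B 1 j = 1 := if_pos fun x k => (hB x k).trans h
      rw [this]
      simp [cdfIter, h]
    · simpa [cdfIter, h] using cdfIter_nonneg hp B 1 j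
  | succ t ih => exact cdfStep_mono hp ih j

end cdfIter

/-! ### Existence and uniqueness of the stationary law. -/

theorem sum_range_real_singleton_le_one (a : Measure ℕ) [IsProbabilityMeasure a] (n : ℕ) :
    ∑ k ∈ Finset.range n, a.real {k} ≤ 1 := by
  rw [sum_measureReal_singleton]
  exact measureReal_le_one

/-- Otherwise arrivals would be at least `S` almost surely, and so would their mean. This supplies
the strictness needed in the maximum principle. -/
theorem exists_lt_real_singleton_pos {a : Measure ℕ} [IsProbabilityMeasure a] {S : ℕ}
    (hint : Integrable (fun k : ℕ => (k : ℝ)) a) (hS : ∫ k, (k : ℝ) ∂a < S) :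
    ∃ k < S, 0 < a.real {k} := by
  by_contra! h
  have h1 : ∀ᵐ k : ℕ ∂a, (S : ℝ) ≤ k := by
    rw [ae_iff_of_countable]
    intro k hk
    by_contra! hkS
    refine hk ?_
    have := le_antisymm (h k (by exact_mod_cast hkS)) measureReal_nonneg
    rwa [measureReal_eq_zero_iff] at this
  have := integral_mono_ae (integrable_const _) hint h1
  simp at this
  linarith

theorem map_prod_eq_iff_cdfStep {S : ℕ} {f : ℕ → ℕ → ℕ} (hf : IsPlayoutStep S f) (q a : Measure ℕ)
    [IsProbabilityMeasure q] [IsProbabilityMeasure a] :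
    ((q.prod a).map fun z => f z.1 z.2) = q ↔ ∀ j, cdfStep S f (fun k => a.real {k})
      (fun i => q.real (Set.Iic i)) j = q.real (Set.Iic j) := by
  have := Measure.isProbabilityMeasure_map (μ := q.prod a) (f := fun z : ℕ × ℕ => f z.1 z.2)
    (by fun_prop)
  simp_rw [← real_map_prod_Iic hf]
  exact ⟨fun h j => by rw [h], fun h => ext_of_real_Iic h⟩

theorem tendsto_real_singleton {qs : ℕ → Measure ℕ} [∀ t, IsProbabilityMeasure (qs t)]
    {q : Measure ℕ} [IsProbabilityMeasure q]
    (h : ∀ j, Tendsto (fun t => (qs t).real (Set.Iic j)) atTop (𝓝 (q.real (Set.Iic j)))) (i : ℕ) :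
    Tendsto (fun t => (qs t).real {i}) atTop (𝓝 (q.real {i})) := by
  cases i with
  | zero =>
    have : ({0} : Set ℕ) = Set.Iic 0 := by ext x; simp
    rw [this]
    exact h 0
  | succ i =>
    have h1 : ∀ r : Measure ℕ, IsProbabilityMeasure r →
        r.real {i + 1} = r.real (Set.Iic (i + 1)) - r.real (Set.Iic i) := by
      intro r _
      rw [real_Iic_succ]
      ring
    rw [h1 q inferInstance]
    simp_rw [fun t => h1 (qs t) inferInstance]
    exact (h _).sub (h _)

section Limit

variable {Ω : Type*} [MeasurableSpace Ω] {μ : Measure Ω} [IsProbabilityMeasure μ]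
  {A : ℕ → Ω → ℕ} {S : ℕ} {f : ℕ → ℕ → ℕ} {a : Measure ℕ}

/-- If the distribution functions of the chain converge to a function with limit `1` at infinity,
then the chain has exactly one stationary distribution, which is the limit of its laws. -/
theorem exists_unique_stationary [IsProbabilityMeasure a] (hf : IsPlayoutStep S f)
    (hmeas : ∀ t, Measurable (A t)) (hindep : iIndepFun A μ) (hlaw : ∀ t, μ.map (A t) = a)
    (hk : ∃ k < S, 0 < a.real {k}) {F : ℕ → ℝ}
    (hF : ∀ j, Tendsto (fun t => cdfIter S f (fun k => a.real {k}) 0 t j) atTop (𝓝 (F j)))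
    (hF1 : Tendsto F atTop (𝓝 1)) :
    ∃ q : Measure ℕ, IsProbabilityMeasure q ∧ (∀ j, q.real (Set.Iic j) = F j) ∧
      ((q.prod a).map fun z => f z.1 z.2) = q ∧
      (∀ ν : Measure ℕ, IsProbabilityMeasure ν → ((ν.prod a).map fun z => f z.1 z.2) = ν → ν = q) ∧
      ∀ i, Tendsto (fun t => μ.real {ω | path f 0 (A · ω) t = i}) atTop (𝓝 (q.real {i})) := by
  have hfix := cdfStep_eq_of_tendsto (fun _ _ => rfl) hF
  simp_rw [← real_path_le hf hmeas hindep hlaw] at hF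
  have hmono : Monotone F := fun i j hij =>
    le_of_tendsto_of_tendsto' (hF i) (hF j) fun t =>
      have := Measure.isProbabilityMeasure_map (μ := μ) (measurable_path hmeas f 0 t).aemeasurable
      measureReal_mono (Set.Iic_subset_Iic.2 hij)
  have h0 : ∀ j, 0 ≤ F j := fun j => ge_of_tendsto' (hF j) fun t => measureReal_nonneg
  obtain ⟨q, hq, hqF⟩ := exists_measure_of_cdf hmono h0 hF1
  refine ⟨q, hq, hqF, ?_, ?_, ?_⟩
  · rw [map_prod_eq_iff_cdfStep hf]
    simpa only [hqF] using hfix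
  · intro ν hν hνs
    rw [map_prod_eq_iff_cdfStep hf] at hνs
    refine ext_of_real_Iic fun j => ?_
    rw [hqF]
    exact congrFun (eq_of_cdfStep_eq (fun _ => measureReal_nonneg)
      (sum_range_real_singleton_le_one a) hk hνs hfix (tendsto_real_Iic ν) hF1) j
  · intro i
    simp_rw [← hqF] at hF
    have : ∀ t, IsProbabilityMeasure (μ.map fun ω => path f 0 (A · ω) t) := fun t =>
      Measure.isProbabilityMeasure_map (measurable_path hmeas f 0 t).aemeasurable
    have h1 := tendsto_real_singleton hF i
    simp_rw [fun t => map_measureReal_apply (μ := μ) (measurable_path hmeas f 0 t)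
      (MeasurableSet.of_discrete (s := {i}))] at h1
    exact h1

/-! ### Negative drift and tightness of the infinite queue. -/

theorem queueStep_cast (S x k : ℕ) :
    (queueStep S x k : ℝ) = x + k - S + ((S - x : ℕ) : ℝ) := by
  have : queueStep S x k + S = x + k + (S - x) := by unfold queueStep; omega
  have : (queueStep S x k : ℝ) + S = x + k + ((S - x : ℕ) : ℝ) := by exact_mod_cast this
  linarith

/-- Layer-cake form of the unused capacity: its mean becomes a sum of distribution function values.
-/
theorem natCast_tsub_eq_sum (S x : ℕ) :
    ((S - x : ℕ) : ℝ) = ∑ j ∈ Finset.range S, (Set.Iic j).indicator 1 x := by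
  induction S with
  | zero => simp
  | succ S ih =>
    rw [Finset.sum_range_succ, ← ih]
    by_cases h : x ≤ S
    · simp [h, Nat.succ_sub h]
    · simp [h, show S + 1 - x = 0 by omega, show S - x = 0 by omega]

theorem integral_natCast_tsub (q : Measure ℕ) [IsProbabilityMeasure q] (S : ℕ) :
    ∫ x, ((S - x : ℕ) : ℝ) ∂q = ∑ j ∈ Finset.range S, q.real (Set.Iic j) := by
  simp_rw [natCast_tsub_eq_sum]
  rw [integral_finsetSum _ fun j _ => (integrable_const 1).indicator .of_discrete]
  exact Finset.sum_congr rfl fun j _ => integral_indicator_one .of_discrete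

theorem integrable_natCast_tsub (q : Measure ℕ) [IsProbabilityMeasure q] (S : ℕ) :
    Integrable (fun x => ((S - x : ℕ) : ℝ)) q := by
  simp_rw [natCast_tsub_eq_sum]
  exact integrable_finsetSum _ fun j _ => (integrable_const 1).indicator .of_discrete

/-- Change of the expected queue length in one frame. -/
theorem integral_queue_succ (hmeas : ∀ t, Measurable (A t)) (hindep : iIndepFun A μ)
    (hlaw : ∀ t, μ.map (A t) = a) (hint : Integrable (fun k : ℕ => (k : ℝ)) a) (t : ℕ) :
    Integrable (fun ω => (path (queueStep S) 0 (A · ω) t : ℝ)) μ ∧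
    ∫ ω, (path (queueStep S) 0 (A · ω) (t + 1) : ℝ) ∂μ =
      ∫ ω, (path (queueStep S) 0 (A · ω) t : ℝ) ∂μ + ∫ k, (k : ℝ) ∂a - S +
        ∑ j ∈ Finset.range S, cdfIter S (queueStep S) (fun k => a.real {k}) 0 t j := by
  have hA : ∀ t, Integrable (fun ω => (A t ω : ℝ)) μ := fun t =>
    (integrable_map_measure (f := A t) (g := fun k : ℕ => (k : ℝ)) (by fun_prop)
      (hmeas t).aemeasurable).1 (by rwa [hlaw])
  have hp := measurable_path hmeas (queueStep S) 0
  have hprob := fun t => Measure.isProbabilityMeasure_map (μ := μ) (hp t).aemeasurable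
  have hsub : ∀ t, Integrable (fun ω => ((S - path (queueStep S) 0 (A · ω) t : ℕ) : ℝ)) μ := by
    intro t
    exact (integrable_map_measure (f := fun ω => path (queueStep S) 0 (A · ω) t)
      (g := fun x : ℕ => ((S - x : ℕ) : ℝ)) (by fun_prop) (hp t).aemeasurable).1
      (integrable_natCast_tsub _ S)
  have hQ : ∀ t, Integrable (fun ω => (path (queueStep S) 0 (A · ω) t : ℝ)) μ := by
    intro t
    induction t with
    | zero => simp [path]
    | succ t ih =>
      simp only [path, queueStep_cast]
      exact ((ih.add (hA t)).sub (integrable_const _)).add (hsub t)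
  refine ⟨hQ t, ?_⟩
  have h1 : Integrable (fun ω => (path (queueStep S) 0 (A · ω) t : ℝ) + A t ω) μ :=
    (hQ t).add (hA t)
  have h2 : Integrable (fun ω => (path (queueStep S) 0 (A · ω) t : ℝ) + A t ω - S) μ :=
    h1.sub (integrable_const _)
  simp only [path, queueStep_cast]
  rw [integral_add h2 (hsub t), integral_sub h1 (integrable_const _),
    integral_add (hQ t) (hA t)]
  congr 1
  · rw [← hlaw t, integral_map (hmeas t).aemeasurable (by fun_prop)]
    simp
  · simp_rw [← real_path_le (isPlayoutStep_queueStep S) hmeas hindep hlaw]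
    rw [← integral_natCast_tsub, integral_map (hp t).aemeasurable (by fun_prop)]

theorem cdfStep_queueStep (S : ℕ) (p F : ℕ → ℝ) (j : ℕ) :
    cdfStep S (queueStep S) p F j = ∑ k ∈ Finset.range (j + 1), p k * F (S + j - k) := by
  refine if_neg fun h => ?_
  have := h 0 (j + 1)
  unfold queueStep at this
  omega

/-- The queue does not escape to infinity when the mean number of arrivals is below `S`. -/
theorem tendsto_one_of_cdfIter_queueStep [IsProbabilityMeasure a] (hmeas : ∀ t, Measurable (A t))
    (hindep : iIndepFun A μ)
    (hlaw : ∀ t, μ.map (A t) = a) (hint : Integrable (fun k : ℕ => (k : ℝ)) a)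
    (hS : ∫ k, (k : ℝ) ∂a < S) {F : ℕ → ℝ}
    (hF : ∀ j, Tendsto (fun t => cdfIter S (queueStep S) (fun k => a.real {k}) 0 t j) atTop
      (𝓝 (F j))) : Tendsto F atTop (𝓝 1) := by
  have hfix := cdfStep_eq_of_tendsto (fun _ _ => rfl) hF
  have hF' := hF
  simp_rw [← real_path_le (isPlayoutStep_queueStep S) hmeas hindep hlaw] at hF'
  have hprob := fun t => Measure.isProbabilityMeasure_map (μ := μ)
    (measurable_path hmeas (queueStep S) 0 t).aemeasurable
  have hmono : Monotone F := fun i j hij =>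
    le_of_tendsto_of_tendsto' (hF' i) (hF' j) fun t => measureReal_mono (Set.Iic_subset_Iic.2 hij)
  have h0 : ∀ j, 0 ≤ F j := fun j => ge_of_tendsto' (hF' j) fun t => measureReal_nonneg
  have h1 : ∀ j, F j ≤ 1 := fun j => le_of_tendsto' (hF' j) fun t => measureReal_le_one
  have hlim := tendsto_atTop_ciSup hmono ⟨1, by rintro _ ⟨j, rfl⟩; exact h1 j⟩
  set c := ⨆ j, F j
  have hFc : ∀ j, F j ≤ c := fun j => hmono.ge_of_tendsto hlim j
  have hc1 : c ≤ 1 := le_of_tendsto' hlim h1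
  -- If `c = 0`, every `F j` vanishes and the mean unused capacity tends to 0. The mean queue length
  -- then eventually drops by a fixed amount each frame, which is impossible for a nonnegative
  -- quantity.
  have hcpos : 0 < c := by
    by_contra! hc
    have hF0 : ∀ j, F j = 0 := fun j => le_antisymm ((hFc j).trans hc) (h0 j)
    have hsum : Tendsto (fun t => ∑ j ∈ Finset.range S,
        cdfIter S (queueStep S) (fun k => a.real {k}) 0 t j) atTop (𝓝 0) := by
      simpa [hF0] using tendsto_finsetSum (Finset.range S) fun j _ => hF j
    -- Half the gap between `S` and the mean: even with unused capacity `η` the drift is at most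
    -- `-η`.
    obtain ⟨η, hη, hηS⟩ : ∃ η > 0, ∫ k, (k : ℝ) ∂a - S + η ≤ -η :=
      ⟨(S - ∫ k, (k : ℝ) ∂a) / 2, by linarith, by linarith⟩
    obtain ⟨t₀, ht₀⟩ := eventually_atTop.1 (hsum.eventually (gt_mem_nhds hη))
    have hdec : ∀ n : ℕ, ∫ ω, (path (queueStep S) 0 (A · ω) (t₀ + n) : ℝ) ∂μ ≤
        ∫ ω, (path (queueStep S) 0 (A · ω) t₀ : ℝ) ∂μ - n * η := by
      intro n
      induction n with
      | zero => simp
      | succ n ih =>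
        have h2 := (integral_queue_succ (S := S) hmeas hindep hlaw hint (t₀ + n)).2
        have h3 := ht₀ (t₀ + n) (by omega)
        rw [← add_assoc, h2]
        push_cast
        linarith
    obtain ⟨n, hn⟩ := exists_nat_gt ((∫ ω, (path (queueStep S) 0 (A · ω) t₀ : ℝ) ∂μ) / η)
    rw [div_lt_iff₀ hη] at hn
    have h4 : 0 ≤ ∫ ω, (path (queueStep S) 0 (A · ω) (t₀ + n) : ℝ) ∂μ :=
      integral_nonneg fun _ => Nat.cast_nonneg _
    linarith [hdec n]
  -- `F / c` is a fixed point by linearity and lies below the initial function 1, hence below every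
  -- iterate. Letting `t`, then `j`, tend to infinity gives `c / c ≤ c`.
  have hdom : ∀ t j, F j / c ≤ cdfIter S (queueStep S) (fun k => a.real {k}) 0 t j := by
    intro t
    induction t with
    | zero => intro j; simpa [cdfIter] using (div_le_one hcpos).2 (hFc j)
    | succ t ih =>
      intro j
      refine le_trans (le_of_eq ?_) (cdfStep_mono (fun _ => measureReal_nonneg) ih j)
      rw [← hfix j, cdfStep_queueStep, cdfStep_queueStep, Finset.sum_div]
      exact Finset.sum_congr rfl fun k _ => mul_div_assoc _ _ _
  have h5 : c / c ≤ c := le_of_tendsto_of_tendsto' (hlim.div_const c) hlim fun j =>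
    ge_of_tendsto' (hF j) fun t => hdom t j
  rw [div_self hcpos.ne'] at h5
  rwa [le_antisymm hc1 h5] at hlim

end Limit

/-- In equilibrium the mean number of packets played out per frame equals the mean number of
arrivals. -/
theorem sum_real_Iic_of_stationary {q a : Measure ℕ} [IsProbabilityMeasure q]
    [IsProbabilityMeasure a] {S : ℕ} (hint : Integrable (fun k : ℕ => (k : ℝ)) a)
    (hq : ((q.prod a).map fun z => queueStep S z.1 z.2) = q) :
    ∑ j ∈ Finset.range S, q.real (Set.Iic j) = S - ∫ k, (k : ℝ) ∂a := by
  -- The stationary mean may be infinite, since only a first moment of the arrivals is assumed.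
  -- Truncating at `N` gives increments of mean zero, dominated by `S` plus the arrivals.
  let g : ℕ → ℕ × ℕ → ℝ := fun N z => (min N (queueStep S z.1 z.2) : ℕ) - (min N z.1 : ℕ)
  have hbdd : ∀ (ν : Measure (ℕ × ℕ)) [IsProbabilityMeasure ν] (N : ℕ) (h : ℕ × ℕ → ℕ),
      Integrable (fun z => ((min N (h z) : ℕ) : ℝ)) ν := by
    intro ν _ N h
    refine Integrable.of_bound (C := N) (by fun_prop) (ae_of_all _ fun z => ?_)
    rw [Real.norm_natCast]
    exact_mod_cast min_le_left _ _
  have hzero : ∀ N, ∫ z, g N z ∂(q.prod a) = 0 := by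
    intro N
    simp only [g]
    rw [integral_sub (hbdd _ N _) (hbdd _ N _), sub_eq_zero]
    have h1 : ∫ x, ((min N x : ℕ) : ℝ) ∂q =
        ∫ z, ((min N (queueStep S z.1 z.2) : ℕ) : ℝ) ∂(q.prod a) := by
      conv_lhs => rw [← hq]
      rw [integral_map (by fun_prop) (by fun_prop)]
    rw [← h1, integral_fun_fst (μ := q) (ν := a) fun x : ℕ => ((min N x : ℕ) : ℝ)]
    simp
  have hlim : Tendsto (fun N => ∫ z, g N z ∂(q.prod a)) atTop
      (𝓝 (∫ z, ((z.2 : ℝ) - S + ((S - z.1 : ℕ) : ℝ)) ∂(q.prod a))) := by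
    refine tendsto_integral_of_dominated_convergence (fun z => (S : ℝ) + z.2)
      (fun N => by fun_prop) ((integrable_const _).add (hint.comp_snd q)) ?_ ?_
    · intro N
      refine ae_of_all _ fun z => ?_
      have h1 : min N (queueStep S z.1 z.2) ≤ min N z.1 + (S + z.2) := by unfold queueStep; omega
      have h2 : min N z.1 ≤ min N (queueStep S z.1 z.2) + (S + z.2) := by unfold queueStep; omega
      have h1' : ((min N (queueStep S z.1 z.2) : ℕ) : ℝ) ≤ (min N z.1 : ℕ) + (S + z.2) := by
        exact_mod_cast h1
      have h2' : ((min N z.1 : ℕ) : ℝ) ≤ (min N (queueStep S z.1 z.2) : ℕ) + (S + z.2) := by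
        exact_mod_cast h2
      rw [Real.norm_eq_abs, abs_le]
      constructor <;> simp only [g] <;> linarith
    · refine ae_of_all _ fun z => ?_
      refine tendsto_const_nhds.congr' ?_
      filter_upwards [eventually_ge_atTop (queueStep S z.1 z.2 + z.1)] with N hN
      simp only [g]
      rw [min_eq_right (by omega), min_eq_right (by omega), queueStep_cast]
      ring
  simp_rw [hzero] at hlim
  have h2 := tendsto_nhds_unique hlim tendsto_const_nhds
  have h3 : Integrable (fun z : ℕ × ℕ => (z.2 : ℝ) - S) (q.prod a) :=
    (hint.comp_snd q).sub (integrable_const _)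
  rw [integral_add h3
    ((integrable_natCast_tsub q S).comp_fst a), integral_sub (hint.comp_snd q) (integrable_const _),
    integral_fun_snd (μ := q) (ν := a) fun x : ℕ => (x : ℝ),
    integral_fun_fst (μ := q) (ν := a) fun x : ℕ => ((S - x : ℕ) : ℝ),
    integral_natCast_tsub] at h2
  simp at h2
  linarith

/-! ### Almost sure long-run frequencies. -/

/-- Averages converge if they do so along every residue class. -/
theorem tendsto_average_of_residues {X : ℕ → ℝ} (h0 : ∀ t, 0 ≤ X t) (h1 : ∀ t, X t ≤ 1) {n : ℕ}
    (hn : 0 < n) {c : ℝ}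
    (h : ∀ r < n, Tendsto (fun K : ℕ => (∑ i ∈ Finset.range K, X (i * n + r)) / K) atTop (𝓝 c)) :
    Tendsto (fun T : ℕ => (∑ t ∈ Finset.range T, X t) / T) atTop (𝓝 c) := by
  have hn' : (0 : ℝ) < n := Nat.cast_pos.2 hn
  have hsplit : ∀ K, ∑ t ∈ Finset.range (K * n), X t =
      ∑ r ∈ Finset.range n, ∑ i ∈ Finset.range K, X (i * n + r) := by
    intro K
    induction K with
    | zero => simp
    | succ K ih =>
      rw [Nat.succ_mul, Finset.sum_range_add, ih, ← Finset.sum_add_distrib]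
      exact Finset.sum_congr rfl fun r _ => (Finset.sum_range_succ _ K).symm
  have hblock : Tendsto (fun K : ℕ => (∑ t ∈ Finset.range (K * n), X t) / K) atTop (𝓝 (n * c)) := by
    simp_rw [hsplit, Finset.sum_div (Finset.range n)]
    simpa using tendsto_finsetSum (Finset.range n) fun r hr => h r (Finset.mem_range.1 hr)
  have hdiv : Tendsto (fun T : ℕ => T / n) atTop atTop := Nat.tendsto_div_const_atTop hn.ne'
  have hratio : Tendsto (fun T : ℕ => ((T / n : ℕ) : ℝ) / T) atTop (𝓝 (1 / n)) := by
    have h2 := (tendsto_nat_floor_mul_div_atTop (R := ℝ) (a := 1 / n) (by positivity)).comp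
      tendsto_natCast_atTop_atTop
    refine h2.congr fun T => ?_
    simp only [Function.comp_apply]
    rw [one_div_mul_eq_div, Nat.floor_div_natCast, Nat.floor_natCast]
  have hlow : Tendsto (fun T : ℕ => (∑ t ∈ Finset.range (T / n * n), X t) / T) atTop (𝓝 c) := by
    have h3 := (hblock.comp hdiv).mul hratio
    rw [show n * c * (1 / n) = c by field_simp] at h3
    refine h3.congr' ?_
    filter_upwards [eventually_ge_atTop n] with T hT
    have : ((T / n : ℕ) : ℝ) ≠ 0 := by
      have := Nat.div_pos hT hn
      positivity
    simp only [Function.comp_apply]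
    field_simp
  -- The incomplete last block contributes between 0 and `n`.
  refine tendsto_of_tendsto_of_tendsto_of_le_of_le hlow
    (by simpa using hlow.add (tendsto_const_div_atTop_nhds_zero_nat (n : ℝ))) ?_ ?_
  · intro T
    simp only
    gcongr
    · exact fun _ _ _ => h0 _
    · exact Nat.div_mul_le_self T n
  · intro T
    simp only
    rw [← add_div]
    gcongr
    have hT : T = T / n * n + T % n := (Nat.div_add_mod' T n).symm
    conv_lhs => rw [hT, Finset.sum_range_add]
    gcongr
    calc ∑ x ∈ Finset.range (T % n), X (T / n * n + x) ≤ ∑ x ∈ Finset.range (T % n), 1 :=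
          Finset.sum_le_sum fun _ _ => h1 _
      _ ≤ n := by simpa using (Nat.mod_lt T hn).le

section Ergodic

variable {Ω : Type*} [MeasurableSpace Ω] {μ : Measure Ω} [IsProbabilityMeasure μ]
  {A : ℕ → Ω → ℕ} {S : ℕ} {f : ℕ → ℕ → ℕ} {a : Measure ℕ}

theorem real_window_le (hf : IsPlayoutStep S f) (hmeas : ∀ t, Measurable (A t))
    (hindep : iIndepFun A μ) (hlaw : ∀ t, μ.map (A t) = a) (x s n j : ℕ) :
    (μ.map fun ω => path f x (fun i => A (s + i) ω) n).real (Set.Iic j) =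
      cdfIter S f (fun k => a.real {k}) x n j :=
  real_path_le (A := fun i => A (s + i)) hf (fun _ => hmeas _)
    (hindep.precomp (add_right_injective s)) (fun _ => hlaw _) x n j

/-- Long-run frequency of a threshold event for the state reached by restarting the chain at `x`
every time `n` frames earlier. -/
theorem ae_tendsto_window (hf : IsPlayoutStep S f) (hmeas : ∀ t, Measurable (A t))
    (hindep : iIndepFun A μ) (hlaw : ∀ t, μ.map (A t) = a) (x j : ℕ) {n : ℕ} (hn : 0 < n) :
    ∀ᵐ ω ∂μ, Tendsto (fun T : ℕ => (∑ s ∈ Finset.range T,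
      (Set.Iic j).indicator (1 : ℕ → ℝ) (path f x (fun i => A (s + i) ω) n)) / T) atTop
      (𝓝 (cdfIter S f (fun k => a.real {k}) x n j)) := by
  have hm : ∀ s, Measurable fun ω => path f x (fun i => A (s + i) ω) n := fun s =>
    measurable_path (A := fun i => A (s + i)) (fun _ => hmeas _) f x n
  have hI : Measurable ((Set.Iic j).indicator (1 : ℕ → ℝ)) := measurable_of_countable _
  -- Windows of length `n` starting in one residue class modulo `n` use disjoint blocks of arrivals,
  -- so the strong law applies.
  have hres : ∀ r, ∀ᵐ ω ∂μ, Tendsto (fun K : ℕ => (∑ i ∈ Finset.range K,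
      (Set.Iic j).indicator (1 : ℕ → ℝ) (path f x (fun l => A (i * n + r + l) ω) n)) / K) atTop
      (𝓝 (cdfIter S f (fun k => a.real {k}) x n j)) := by
    intro r
    have hident : ∀ s t, IdentDistrib (fun ω => path f x (fun l => A (s + l) ω) n)
        (fun ω => path f x (fun l => A (t + l) ω) n) μ μ := by
      intro s t
      refine ⟨(hm s).aemeasurable, (hm t).aemeasurable, ?_⟩
      have := Measure.isProbabilityMeasure_map (μ := μ) (hm s).aemeasurable
      have := Measure.isProbabilityMeasure_map (μ := μ) (hm t).aemeasurable
      refine ext_of_real_Iic fun i => ?_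
      rw [real_window_le hf hmeas hindep hlaw, real_window_le hf hmeas hindep hlaw]
    have hpair : ∀ i k, i < k → IndepFun
        (fun ω => (Set.Iic j).indicator (1 : ℕ → ℝ) (path f x (fun l => A (i * n + r + l) ω) n))
        (fun ω => (Set.Iic j).indicator (1 : ℕ → ℝ) (path f x (fun l => A (k * n + r + l) ω) n))
        μ := by
      intro i k hik
      refine (indepFun_path_path hmeas hindep f x (s := i * n + r) (t := k * n + r) (m := n) n
        ?_).comp hI hI
      have := Nat.mul_le_mul_right n (Nat.succ_le_of_lt hik)
      rw [Nat.succ_mul] at this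
      omega
    have hslln := strong_law_ae_real (μ := μ) (fun i ω => (Set.Iic j).indicator (1 : ℕ → ℝ)
      (path f x (fun l => A (i * n + r + l) ω) n)) ?_ ?_ fun i => (hident _ _).comp hI
    · have hmean : ∫ ω, (Set.Iic j).indicator (1 : ℕ → ℝ)
          (path f x (fun l => A (0 * n + r + l) ω) n) ∂μ =
          cdfIter S f (fun k => a.real {k}) x n j := by
        rw [← real_window_le hf hmeas hindep hlaw x (0 * n + r), ← integral_indicator_one .of_discrete,
          integral_map (hm _).aemeasurable (by fun_prop)]
      rwa [hmean] at hslln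
    · refine Integrable.of_bound (C := 1) (hI.comp (hm _)).aestronglyMeasurable
        (ae_of_all _ fun ω => ?_)
      refine (norm_indicator_le_norm_self _ _).trans ?_
      simp
    · intro i k hik
      rcases lt_or_gt_of_ne hik with h | h
      · exact hpair i k h
      · exact (hpair k i h).symm
  filter_upwards [ae_all_iff.2 hres] with ω hω
  refine tendsto_average_of_residues (fun t => ?_) (fun t => ?_) hn fun r _ => hω r
  · exact Set.indicator_nonneg (fun _ _ => zero_le_one) _
  · exact Set.indicator_le_self' (fun _ _ => zero_le_one) _

/-- Almost sure long-run frequencies of a truncated chain. -/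
theorem ae_tendsto_frequency [IsProbabilityMeasure a] (hf : IsPlayoutStep S f)
    (hmeas : ∀ t, Measurable (A t))
    (hindep : iIndepFun A μ) (hlaw : ∀ t, μ.map (A t) = a) (hk : ∃ k < S, 0 < a.real {k}) {B : ℕ}
    (hB : ∀ x k, f x k ≤ B) {F : ℕ → ℝ}
    (hF : ∀ j, Tendsto (fun t => cdfIter S f (fun k => a.real {k}) 0 t j) atTop (𝓝 (F j))) (j : ℕ) :
    ∀ᵐ ω ∂μ, Tendsto (fun T : ℕ => (∑ t ∈ Finset.range T,
      (Set.Iic j).indicator (1 : ℕ → ℝ) (path f 0 (A · ω) t)) / T) atTop (𝓝 (F j)) := by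
  have hp : ∀ k, 0 ≤ a.real {k} := fun _ => measureReal_nonneg
  have hp1 := sum_range_real_singleton_le_one a
  -- The limit from `B` is also a fixed point equal to 1 from `B` on, so it coincides with the limit
  -- from 0.
  have hU : ∀ i, Tendsto (fun t => cdfIter S f (fun k => a.real {k}) B t i) atTop (𝓝 (F i)) := by
    have hG := fun i => tendsto_atTop_ciSup (cdfIter_top_monotone (S := S) hp hB i)
      ⟨1, by rintro _ ⟨t, rfl⟩; exact cdfIter_le_one hp hp1 B t i⟩
    have hGfix := cdfStep_eq_of_tendsto (fun _ _ => rfl) hG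
    have hFfix := cdfStep_eq_of_tendsto (fun _ _ => rfl) hF
    have hone : ∀ H : ℕ → ℝ, (∀ i, cdfStep S f (fun k => a.real {k}) H i = H i) →
        Tendsto H atTop (𝓝 1) := by
      intro H hH
      refine tendsto_const_nhds.congr' ?_
      filter_upwards [eventually_ge_atTop B] with i hi
      rw [← hH i]
      exact (if_pos fun x k => (hB x k).trans hi).symm
    rw [eq_of_cdfStep_eq hp hp1 hk hFfix hGfix (hone _ hFfix) (hone _ hGfix)]
    exact hG
  have hwin := fun x => ae_all_iff.2 fun n : ℕ =>
    ae_tendsto_window hf hmeas hindep hlaw x j n.succ_pos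
  filter_upwards [hwin 0, hwin B] with ω hL hU'
  have hle : ∀ t, path f 0 (A · ω) t ≤ B := by
    rintro (_ | t)
    · exact Nat.zero_le _
    · exact hB _ _
  have hind : ∀ {x y : ℕ}, x ≤ y →
      (Set.Iic j).indicator (1 : ℕ → ℝ) y ≤ (Set.Iic j).indicator (1 : ℕ → ℝ) x := by
    intro x y hxy
    by_cases hy : y ≤ j
    · simp [hy, hxy.trans hy]
    · rw [Set.indicator_of_notMem (show y ∉ Set.Iic j from hy)]
      exact Set.indicator_nonneg (fun _ _ => zero_le_one) _
  have hind0 : ∀ x, 0 ≤ (Set.Iic j).indicator (1 : ℕ → ℝ) x :=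
    Set.indicator_nonneg fun _ _ => zero_le_one
  have hind1 : ∀ (y : ℕ → ℕ) (n : ℕ),
      ∑ t ∈ Finset.range n, (Set.Iic j).indicator (1 : ℕ → ℝ) (y t) ≤ n := by
    intro y n
    refine (Finset.sum_le_sum fun t _ =>
      Set.indicator_le_self' (f := (1 : ℕ → ℝ)) (fun _ _ => zero_le_one) (y t)).trans ?_
    simp
  -- The state at `s + n` dominates the chain restarted at 0 at time `s`; the extra `n` pays for the
  -- first `n` frames.
  have hupper : ∀ n T : ℕ, ∑ t ∈ Finset.range T,
      (Set.Iic j).indicator (1 : ℕ → ℝ) (path f 0 (A · ω) t) ≤ ∑ s ∈ Finset.range T,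
        (Set.Iic j).indicator (1 : ℕ → ℝ) (path f 0 (fun i => A (s + i) ω) n) + n := by
    intro n T
    calc _ ≤ ∑ t ∈ Finset.range (n + T),
            (Set.Iic j).indicator (1 : ℕ → ℝ) (path f 0 (A · ω) t) :=
          Finset.sum_le_sum_of_subset_of_nonneg (Finset.range_subset_range.2 (by omega))
            fun _ _ _ => hind0 _
      _ ≤ _ := by
        rw [Finset.sum_range_add, add_comm]
        refine add_le_add (Finset.sum_le_sum fun s _ => hind ?_) (hind1 _ n)
        rw [add_comm n s, path_add]
        exact path_mono hf.monotone (Nat.zero_le _) _ _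
  -- The state at time `s` is at most `B`, so restarting from `B` dominates it `n` frames later.
  have hlower : ∀ n T : ℕ, ∑ s ∈ Finset.range T,
      (Set.Iic j).indicator (1 : ℕ → ℝ) (path f B (fun i => A (s + i) ω) n) - n ≤
        ∑ t ∈ Finset.range T, (Set.Iic j).indicator (1 : ℕ → ℝ) (path f 0 (A · ω) t) := by
    intro n T
    have h1 : ∑ s ∈ Finset.range T,
        (Set.Iic j).indicator (1 : ℕ → ℝ) (path f B (fun i => A (s + i) ω) n) ≤
        ∑ t ∈ Finset.range (n + T), (Set.Iic j).indicator (1 : ℕ → ℝ) (path f 0 (A · ω) t) := by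
      rw [Finset.sum_range_add]
      refine le_add_of_nonneg_of_le (Finset.sum_nonneg fun _ _ => hind0 _)
        (Finset.sum_le_sum fun s _ => hind ?_)
      rw [add_comm n s, path_add]
      exact path_mono hf.monotone (hle s) _ _
    rw [add_comm n T, Finset.sum_range_add] at h1
    linarith [hind1 (fun i => path f 0 (A · ω) (T + i)) n]
  -- A window length is fixed first so that its frequency beats `b`; then `T` tends to infinity. The
  -- shift by 1 keeps the length positive.
  refine tendsto_order.2 ⟨fun b hb => ?_, fun b hb => ?_⟩
  · obtain ⟨n, hn⟩ := (((tendsto_add_atTop_iff_nat 1).2 (hU j)).eventually (lt_mem_nhds hb)).exists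
    have h2 := (hU' n).sub (tendsto_const_div_atTop_nhds_zero_nat ((n + 1 : ℕ) : ℝ))
    rw [sub_zero] at h2
    filter_upwards [h2.eventually (lt_mem_nhds hn)] with T hT
    rw [← sub_div] at hT
    exact hT.trans_le (div_le_div_of_nonneg_right (hlower _ _) (Nat.cast_nonneg _))
  · obtain ⟨n, hn⟩ := (((tendsto_add_atTop_iff_nat 1).2 (hF j)).eventually (gt_mem_nhds hb)).exists
    have h2 := (hL n).add (tendsto_const_div_atTop_nhds_zero_nat ((n + 1 : ℕ) : ℝ))
    rw [add_zero] at h2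
    filter_upwards [h2.eventually (gt_mem_nhds hn)] with T hT
    rw [← add_div] at hT
    exact (div_le_div_of_nonneg_right (hupper _ _) (Nat.cast_nonneg _)).trans_lt hT

end Ergodic

/-! ### From frequencies to outage and drop rate. -/

theorem sum_real_singleton_eq_real_Iic (q : Measure ℕ) [IsProbabilityMeasure q] (n : ℕ) :
    ∑ i ∈ Finset.range (n + 1), q.real {i} = q.real (Set.Iic n) := by
  rw [sum_measureReal_singleton]
  congr 1
  ext x
  simp

/-- Summation by parts: the mass at `i` is counted once for each threshold `j` with `i ≤ j < S`. -/
theorem sum_weighted_real_singleton (q : Measure ℕ) [IsProbabilityMeasure q] (S : ℕ) :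
    ∑ i ∈ Finset.range S, ((S : ℝ) - i) * q.real {i} =
      ∑ j ∈ Finset.range S, q.real (Set.Iic j) := by
  induction S with
  | zero => simp
  | succ S ih =>
    rw [Finset.sum_range_succ (fun j => q.real (Set.Iic j)), ← ih,
      ← sum_real_singleton_eq_real_Iic, Finset.sum_range_succ (fun i => q.real {i}),
      Finset.sum_range_succ _ S, ← add_assoc, ← Finset.sum_add_distrib]
    push_cast
    congr 1
    · exact Finset.sum_congr rfl fun i _ => by ring
    · ring

theorem sum_playout_deficit (q : Measure ℕ) [IsProbabilityMeasure q] {S : ℕ} (hS : 0 < S) :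
    ∑ i ∈ Finset.range S, (1 - (i : ℝ) / S) * q.real {i} =
      (∑ j ∈ Finset.range S, q.real (Set.Iic j)) / S := by
  have : (S : ℝ) ≠ 0 := by positivity
  rw [← sum_weighted_real_singleton, Finset.sum_div]
  exact Finset.sum_congr rfl fun i _ => by field_simp

/-- Conservation of packets in the finite buffer. -/
theorem sum_dropped {Ω : Type*} (B S : ℕ) (A : ℕ → Ω → ℕ) (T : ℕ) (ω : Ω) :
    ∑ t ∈ Finset.range T, (dropped B S A t ω : ℝ) =
      ∑ t ∈ Finset.range T, (A t ω : ℝ) +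
        ∑ t ∈ Finset.range T, ((S - buffer B S A t ω : ℕ) : ℝ) - T * S - buffer B S A T ω := by
  induction T with
  | zero => simp [buffer]
  | succ T ih =>
    have h : dropped B S A T ω + buffer B S A (T + 1) ω + S =
        buffer B S A T ω + (S - buffer B S A T ω) + A T ω := by
      have : buffer B S A (T + 1) ω ≤ max S (buffer B S A T ω) - S + A T ω := min_le_right _ _
      unfold dropped
      omega
    have h' : (dropped B S A T ω : ℝ) + buffer B S A (T + 1) ω + S =
        buffer B S A T ω + ((S - buffer B S A T ω : ℕ) : ℝ) + A T ω := by exact_mod_cast h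
    simp_rw [Finset.sum_range_succ, ih]
    push_cast
    linarith

section Frequencies

variable {Ω : Type*} [MeasurableSpace Ω] {μ : Measure Ω} {A : ℕ → Ω → ℕ} {B S : ℕ}
  {qB : Measure ℕ} [IsProbabilityMeasure qB]

theorem hasOutage_of_frequency (hS : 0 < S)
    (hfreq : ∀ j, ∀ᵐ ω ∂μ, Tendsto (fun T : ℕ => (∑ t ∈ Finset.range T,
      (Set.Iic j).indicator (1 : ℕ → ℝ) (buffer B S A t ω)) / T) atTop (𝓝 (qB.real (Set.Iic j)))) :
    HasOutage μ A B S (outageValue S qB) := by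
  obtain ⟨n, rfl⟩ := Nat.exists_eq_succ_of_ne_zero hS.ne'
  filter_upwards [hfreq n] with ω hω
  rw [outageValue, sum_real_singleton_eq_real_Iic]
  refine hω.congr fun T => ?_
  rw [Finset.card_filter]
  push_cast
  congr 1
  refine Finset.sum_congr rfl fun t _ => ?_
  simp [Set.indicator_apply]

theorem hasDropRate_of_frequency (hS : 0 < S) {m : ℝ} (hm : 0 < m) {q : Measure ℕ}
    [IsProbabilityMeasure q] (hq : ∑ j ∈ Finset.range S, q.real (Set.Iic j) = S - m)
    (hA : ∀ᵐ ω ∂μ, Tendsto (fun T : ℕ => (∑ t ∈ Finset.range T, (A t ω : ℝ)) / T) atTop (𝓝 m))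
    (hfreq : ∀ j, ∀ᵐ ω ∂μ, Tendsto (fun T : ℕ => (∑ t ∈ Finset.range T,
      (Set.Iic j).indicator (1 : ℕ → ℝ) (buffer B S A t ω)) / T) atTop (𝓝 (qB.real (Set.Iic j)))) :
    HasDropRate μ A B S (dropValue S q qB) := by
  have hS' : (0 : ℝ) < S := Nat.cast_pos.2 hS
  -- By `hq` the denominator is `m / S`, so `S` cancels. The `- 0` is the limit of the buffer
  -- content divided by `T`.
  have hval : dropValue S q qB = (m + ∑ j ∈ Finset.range S, qB.real (Set.Iic j) - S - 0) / m := by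
    unfold dropValue dropDenominator
    simp_rw [mul_sub, Finset.sum_sub_distrib]
    rw [sum_playout_deficit q hS, sum_playout_deficit qB hS, hq]
    have : 1 - (S - m) / S = m / S := by field_simp; ring
    rw [this]
    field_simp
    ring
  filter_upwards [hA, ae_all_iff.2 hfreq] with ω hω hfω
  rw [hval]
  have hbuf : Tendsto (fun T : ℕ => (buffer B S A T ω : ℝ) / T) atTop (𝓝 0) := by
    refine squeeze_zero (fun T => by positivity) (fun T => ?_)
      (tendsto_const_div_atTop_nhds_zero_nat (B : ℝ))
    gcongr
    exact buffer_le B S A T ω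
  have hdef : Tendsto (fun T : ℕ => (∑ t ∈ Finset.range T, ((S - buffer B S A t ω : ℕ) : ℝ)) / T)
      atTop (𝓝 (∑ j ∈ Finset.range S, qB.real (Set.Iic j))) := by
    refine (tendsto_finsetSum (Finset.range S) fun j _ => hfω j).congr fun T => ?_
    simp_rw [natCast_tsub_eq_sum]
    rw [Finset.sum_comm, Finset.sum_div]
  refine ((((hω.add hdef).sub_const (S : ℝ)).sub hbuf).div hω hm.ne').congr' ?_
  filter_upwards [eventually_gt_atTop 0] with T hT
  have hT' : (T : ℝ) ≠ 0 := by positivity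
  simp only [Pi.div_apply, sum_dropped]
  refine Eq.trans ?_ (div_div_div_cancel_right₀ hT' _ _)
  congr 1
  field_simp

end Frequencies

/-! ### Assembly and optimisation over the playout rate. -/

section Uniqueness

variable {Ω : Type*} [MeasurableSpace Ω] {μ : Measure Ω} [IsProbabilityMeasure μ]
  {A : ℕ → Ω → ℕ} {B S : ℕ}

theorem HasOutage.unique {p p' : ℝ} (h : HasOutage μ A B S p) (h' : HasOutage μ A B S p') :
    p = p' := by
  obtain ⟨ω, hω, hω'⟩ := (h.and h').exists
  exact tendsto_nhds_unique hω hω'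

theorem HasDropRate.unique {d d' : ℝ} (h : HasDropRate μ A B S d) (h' : HasDropRate μ A B S d') :
    d = d' := by
  obtain ⟨ω, hω, hω'⟩ := (h.and h').exists
  exact tendsto_nhds_unique hω hω'

/-- Existence, uniqueness and long-run values of the queue and the buffer below saturation. -/
theorem exists_stationary_and_rates (hmeas : ∀ t, Measurable (A t)) (hindep : iIndepFun A μ)
    (hident : ∀ t, IdentDistrib (A t) (A 0) μ μ)
    (hint : Integrable (fun ω => (A 0 ω : ℝ)) μ) (hpos : 0 < ∫ ω, (A 0 ω : ℝ) ∂μ)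
    (hS : ∫ ω, (A 0 ω : ℝ) ∂μ < S) :
    ∃ q qB : Measure ℕ,
      (IsStationary (queueKernel (μ.map (A 0)) S) q ∧
        (∀ ν, IsStationary (queueKernel (μ.map (A 0)) S) ν → ν = q) ∧
        ∀ i : ℕ, Tendsto (fun t => μ.real {ω | queue S A t ω = i}) atTop (𝓝 (q.real {i}))) ∧
      (IsStationary (bufferKernel (μ.map (A 0)) B S) qB ∧
        (∀ ν, IsStationary (bufferKernel (μ.map (A 0)) B S) ν → ν = qB) ∧
        ∀ i : ℕ, Tendsto (fun t => μ.real {ω | buffer B S A t ω = i}) atTop (𝓝 (qB.real {i}))) ∧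
      HasOutage μ A B S (outageValue S qB) ∧
      0 < dropDenominator S q ∧
      HasDropRate μ A B S (dropValue S q qB) := by
  have hlaw : ∀ t, μ.map (A t) = μ.map (A 0) := fun t => (hident t).map_eq
  have hprob := Measure.isProbabilityMeasure_map (μ := μ) (hmeas 0).aemeasurable
  have hmean : ∫ k, (k : ℝ) ∂(μ.map (A 0)) = ∫ ω, (A 0 ω : ℝ) ∂μ :=
    integral_map (hmeas 0).aemeasurable (by fun_prop)
  have hint' : Integrable (fun k : ℕ => (k : ℝ)) (μ.map (A 0)) :=
    (integrable_map_measure (by fun_prop) (hmeas 0).aemeasurable).2 hint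
  have hA : ∀ᵐ ω ∂μ, Tendsto (fun T : ℕ => (∑ t ∈ Finset.range T, (A t ω : ℝ)) / T) atTop
      (𝓝 (∫ ω, (A 0 ω : ℝ) ∂μ)) :=
    strong_law_ae_real (fun t ω => (A t ω : ℝ)) hint
      (fun s t hst => (hindep.indepFun hst).comp (measurable_of_countable fun k : ℕ => (k : ℝ))
        (measurable_of_countable fun k : ℕ => (k : ℝ)))
      fun t => (hident t).comp (measurable_of_countable fun k : ℕ => (k : ℝ))
  generalize μ.map (A 0) = a at *
  have hSpos : 0 < S := by
    have := hpos.trans hS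
    exact_mod_cast this
  have hk := exists_lt_real_singleton_pos hint' (hmean ▸ hS)
  have hlim : ∀ f : ℕ → ℕ → ℕ, ∃ F : ℕ → ℝ, ∀ j,
      Tendsto (fun t => cdfIter S f (fun k => a.real {k}) 0 t j) atTop (𝓝 (F j)) := fun f =>
    ⟨_, fun j => tendsto_atTop_ciInf (cdfIter_zero_antitone (fun _ => measureReal_nonneg)
      (sum_range_real_singleton_le_one a) j)
      ⟨0, by rintro _ ⟨t, rfl⟩; exact cdfIter_nonneg (fun _ => measureReal_nonneg) 0 t j⟩⟩
  obtain ⟨F, hF⟩ := hlim (queueStep S)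
  obtain ⟨G, hG⟩ := hlim (bufferStep B S)
  have hcap : ∀ x k, bufferStep B S x k ≤ B := fun _ _ => min_le_left _ _
  have hG1 : Tendsto G atTop (𝓝 1) := by
    refine tendsto_const_nhds.congr' ?_
    filter_upwards [eventually_ge_atTop B] with j hj
    rw [← cdfStep_eq_of_tendsto (fun _ _ => rfl) hG j]
    exact (if_pos fun x k => (hcap x k).trans hj).symm
  obtain ⟨q, hq, -, hqs, hqu, hqt⟩ := exists_unique_stationary (isPlayoutStep_queueStep S) hmeas
    hindep hlaw hk hF (tendsto_one_of_cdfIter_queueStep hmeas hindep hlaw hint' (hmean ▸ hS) hF)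
  obtain ⟨qB, hqB, hqBG, hqBs, hqBu, hqBt⟩ := exists_unique_stationary
    (isPlayoutStep_bufferStep B S) hmeas hindep hlaw hk hG hG1
  have hbal := sum_real_Iic_of_stationary hint' hqs
  rw [hmean] at hbal
  have hfreq := ae_tendsto_frequency (isPlayoutStep_bufferStep B S) hmeas hindep hlaw hk hcap hG
  simp_rw [← buffer_eq_path, ← hqBG] at hfreq
  refine ⟨q, qB, ⟨(isStationary_queueKernel_iff S).2 ⟨hq, hqs⟩, fun ν hν => ?_, ?_⟩,
    ⟨(isStationary_bufferKernel_iff B S).2 ⟨hqB, hqBs⟩, fun ν hν => ?_, ?_⟩,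
    hasOutage_of_frequency hSpos hfreq, ?_, hasDropRate_of_frequency hSpos hpos hbal hA hfreq⟩
  · obtain ⟨h1, h2⟩ := (isStationary_queueKernel_iff S).1 hν
    exact hqu ν h1 h2
  · simpa only [queue_eq_path] using hqt
  · obtain ⟨h1, h2⟩ := (isStationary_bufferKernel_iff B S).1 hν
    exact hqBu ν h1 h2
  · simpa only [buffer_eq_path] using hqBt
  · have hS' : (0 : ℝ) < S := Nat.cast_pos.2 hSpos
    rw [dropDenominator, sum_playout_deficit q hSpos, hbal, sub_pos, div_lt_one hS']
    linarith

end Uniqueness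

end PlayoutQueue

theorem mainTheorem1 {Ω : Type*} [MeasurableSpace Ω] (μ : Measure Ω) [IsProbabilityMeasure μ]
    (A : ℕ → Ω → ℕ) (hmeas : ∀ t, Measurable (A t)) (hindep : iIndepFun A μ)
    (hident : ∀ t, IdentDistrib (A t) (A 0) μ μ)
    (hint : Integrable (fun ω => (A 0 ω : ℝ)) μ) (hpos : 0 < ∫ ω, (A 0 ω : ℝ) ∂μ)
    (B : ℕ) (σ Δt ε δ₀ : ℝ) (hσ : 0 < σ) (hΔt : 0 < Δt) :
    (∀ S : ℕ, (∫ ω, (A 0 ω : ℝ) ∂μ) < (S : ℝ) → S < B →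
      ∃ q qB : Measure ℕ,
        (PlayoutQueue.IsStationary (PlayoutQueue.queueKernel (μ.map (A 0)) S) q ∧
          (∀ ν, PlayoutQueue.IsStationary (PlayoutQueue.queueKernel (μ.map (A 0)) S) ν → ν = q) ∧
          ∀ i : ℕ, Tendsto (fun t => μ.real {ω | PlayoutQueue.queue S A t ω = i}) atTop
            (𝓝 (q.real {i}))) ∧
        (PlayoutQueue.IsStationary (PlayoutQueue.bufferKernel (μ.map (A 0)) B S) qB ∧
          (∀ ν, PlayoutQueue.IsStationary (PlayoutQueue.bufferKernel (μ.map (A 0)) B S) ν →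
            ν = qB) ∧
          ∀ i : ℕ, Tendsto (fun t => μ.real {ω | PlayoutQueue.buffer B S A t ω = i}) atTop
            (𝓝 (qB.real {i}))) ∧
        PlayoutQueue.HasOutage μ A B S (PlayoutQueue.outageValue S qB) ∧
        0 < PlayoutQueue.dropDenominator S q ∧
        PlayoutQueue.HasDropRate μ A B S (PlayoutQueue.dropValue S q qB)) ∧
    ((PlayoutQueue.stationaryRates (μ.map (A 0)) B σ Δt ε δ₀).Nonempty →
      ∃ U : ℝ, IsGreatest (PlayoutQueue.feasibleRates μ A B σ Δt ε δ₀) U ∧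
        IsGreatest (PlayoutQueue.stationaryRates (μ.map (A 0)) B σ Δt ε δ₀) U) := by
  have hmain := fun (S : ℕ) (hS : ∫ ω, (A 0 ω : ℝ) ∂μ < S) =>
    PlayoutQueue.exists_stationary_and_rates (B := B) hmeas hindep hident hint hpos hS
  have hmean : ∫ k, (k : ℝ) ∂(μ.map (A 0)) = ∫ ω, (A 0 ω : ℝ) ∂μ :=
    integral_map (hmeas 0).aemeasurable (by fun_prop)
  refine ⟨fun S hS _ => hmain S hS, fun hne => ?_⟩
  have hfin : (PlayoutQueue.stationaryRates (μ.map (A 0)) B σ Δt ε δ₀).Finite := by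
    refine ((Set.finite_Iio B).image fun S : ℕ => (S : ℝ) * σ / Δt).subset ?_
    rintro _ ⟨S, -, hSB, rfl, -⟩
    exact ⟨S, hSB, rfl⟩
  obtain ⟨U, hU, hmax⟩ := hfin.exists_maximalFor id _ hne
  have hgreatest : IsGreatest (PlayoutQueue.stationaryRates (μ.map (A 0)) B σ Δt ε δ₀) U :=
    ⟨hU, fun u hu => (le_total u U).elim id fun h => hmax hu h⟩
  refine ⟨U, ⟨?_, ?_⟩, hgreatest⟩
  · obtain ⟨S, hS, hSB, rfl, q, qB, hq, hqB, ho, hd⟩ := hU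
    rw [hmean] at hS
    obtain ⟨r, rB, ⟨-, hr, -⟩, ⟨-, hrB, -⟩, hout, -, hdrop⟩ := hmain S hS
    -- Uniqueness of the stationary laws identifies the witnesses in the constraints with those
    -- giving the actual rates.
    rw [hr q hq] at hd
    rw [hrB qB hqB] at ho hd
    exact ⟨S, by exact_mod_cast hpos.trans hS, hSB, rfl, ⟨_, hout, ho⟩, ⟨_, hdrop, hd⟩⟩
  · rintro _ ⟨S, hS0, hSB, rfl, ⟨p, hp, hpε⟩, d, hd, hdδ⟩
    by_cases hS : ∫ ω, (A 0 ω : ℝ) ∂μ < S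
    · obtain ⟨q, qB, ⟨hq, -⟩, ⟨hqB, -⟩, hout, -, hdrop⟩ := hmain S hS
      refine hgreatest.2 ⟨S, by rwa [hmean], hSB, rfl, q, qB, hq, hqB, ?_, ?_⟩
      · rwa [hout.unique hp]
      · rwa [hdrop.unique hd]
    -- Here `S ≤ E[A] < S'`, so the rate is below `U` whatever its outage and drop rate are.
    · obtain ⟨S', hS', -, rfl, -⟩ := hU
      rw [hmean] at hS'
      have : (S : ℝ) ≤ S' := (not_lt.1 hS).trans hS'.le
      gcongr
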